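/- Let $\bar d\ge 1$ be an integer, let $h,b>0$, and put $\beta=b/(h+b)$. Let $\Delta$ be the set of probability vectors $f=(f(0),\dots,f(\bar d))$ on $\{0,\dots,\bar d\}$, and let $F_f(d)=\sum_{i\le d}f(i)$. In periods $t=1,2,\dots$ the demands $D_t$ are independent with distribution $f\in\Delta$; write $\mathbb{E}_f$ for expectation under $f$. For $y\in\{0,\dots,\bar d\}$ let $$Q_f(y)=\sum_{d=0}^{\bar d}f(d)\bigl(h\,(y-d)^++b\,(d-y)^+\bigr),\qquad Q_f^*=\min_{0\le y\le\bar d}Q_f(y).$$ An adaptive policy is a sequence $\mathbf y=(y_1,y_2,\dots)$ in which $y_t\in\{0,\dots,\bar d\}$ is a function of the past demands $(d_1,\dots,d_{t-1})$. Its $T$-period regret is $$R_f^T(\mathbf y)=\sum_{t=1}^{T}\mathbb{E}_f\bigl[h\,(y_t-D_t)^++b\,(D_t-y_t)^+\bigr]-Q_f^*\,T,$$ where $y_t=y_t(D_1,\dots,D_{t-1})$. Let $\mathbf y$ be the empirical-newsvendor order-up-to policy for nonperishable items: $y_1=0$ and, for $t\ge 2$, $$y_t=\max\{\hat y_t,\;y_{t-1}-d_{t-1}\},\qquad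 \hat y_t=\min\Bigl\{d\in\{0,\dots,\bar d\}:\hat F_{t-1}(d)\ge\beta\Bigr\},$$ where $\hat F_{t-1}(d)=\frac{1}{t-1}\,\#\{s\le t-1: d_s\le d\}$ is the empirical distribution function of the demands observed so far. Then for every $\varepsilon>0$ there are constants $E_\varepsilon,F_\varepsilon>0$, depending only on $\varepsilon$, $h$, $b$ and $\bar d$ (not on $f$ or $T$), such that for every $T$ $$\sup_{f\in\Delta}R_f^T(\mathbf y)\le E_\varepsilon+F_\varepsilon\,T^{1/2+\varepsilon}.$$ -/

import Mathlib

noncomputable section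

namespace Newsvendor

/-- Cumulative distribution function `F_f(d) = f(0) + ... + f(d)` of a weight vector on
`{0, ..., n}`. -/
def cdf {n : ℕ} (f : Fin (n + 1) → ℝ) (d : Fin (n + 1)) : ℝ :=
  ∑ i ∈ Finset.Iic d, f i

/-- The order-up-to level `min {d ∈ {0, ..., n} | F_f(d) ≥ β}`; see `quantile_isLeast`. -/
def quantile {n : ℕ} (β : ℝ) (f : Fin (n + 1) → ℝ) : Fin (n + 1) :=
  (Finset.univ.filter fun d => β ≤ cdf f d).inf id

/-- For a probability vector `f` and `β ≤ 1` the minimum defining the quantile is attained. -/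
theorem quantile_isLeast {n : ℕ} {β : ℝ} (hβ : β ≤ 1) {f : Fin (n + 1) → ℝ}
    (hf : f ∈ stdSimplex ℝ (Fin (n + 1))) :
    IsLeast {d : Fin (n + 1) | β ≤ cdf f d} (quantile β f) := by
  have hne : (Finset.univ.filter fun d => β ≤ cdf f d).Nonempty := by
    have h1 : (Finset.Iic (Fin.last n) : Finset (Fin (n + 1))) = Finset.univ := by
      ext i; simp [Fin.le_last]
    have h2 : cdf f (Fin.last n) = 1 := by unfold cdf; rw [h1]; exact hf.2
    exact ⟨Fin.last n, by simp [h2, hβ]⟩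
  constructor
  · obtain ⟨d, hd, he⟩ := Finset.exists_mem_eq_inf _ hne (id : Fin (n + 1) → Fin (n + 1))
    have hd2 := (Finset.mem_filter.mp hd).2
    have : quantile β f = d := he
    rw [this]; exact hd2
  · intro d hd
    have hmem : d ∈ Finset.univ.filter fun d => β ≤ cdf f d := by simpa using hd
    exact Finset.inf_le (f := (id : Fin (n + 1) → Fin (n + 1))) hmem

/-- Empirical distribution of the observed demands `d_1, ..., d_t` (used only for `t ≥ 1`). -/
def empirical {n t : ℕ} (d : Fin t → Fin (n + 1)) (i : Fin (n + 1)) : ℝ :=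
  ((Finset.univ.filter fun s => d s = i).card : ℝ) / t

theorem empirical_mem {n t : ℕ} (ht : 0 < t) (d : Fin t → Fin (n + 1)) :
    empirical d ∈ stdSimplex ℝ (Fin (n + 1)) := by
  refine ⟨fun i => by unfold empirical; positivity, ?_⟩
  have h := Finset.card_eq_sum_card_fiberwise (f := d) (s := Finset.univ) (t := Finset.univ)
    (by intro x _; simp)
  have ht0 : (t : ℝ) ≠ 0 := by positivity
  unfold empirical
  rw [← Finset.sum_div, div_eq_one_iff_eq ht0, ← Nat.cast_sum, ← h]
  simp

/-- The expectation `𝔼_f[g(D_1, ..., D_t)]`, where `D_1, ..., D_t` are independent with common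
distribution `f`. -/
def expect {n : ℕ} (f : Fin (n + 1) → ℝ) (t : ℕ) (g : (Fin t → Fin (n + 1)) → ℝ) : ℝ :=
  ∑ d : Fin t → Fin (n + 1), (∏ s, f (d s)) * g d

/-- Cost `h (y - d)⁺ + b (d - y)⁺` of one period with order-up-to level `y` and demand `d`. -/
def periodCost {n : ℕ} (h b : ℝ) (y d : Fin (n + 1)) : ℝ :=
  h * max (((y : ℕ) : ℝ) - ((d : ℕ) : ℝ)) 0 + b * max (((d : ℕ) : ℝ) - ((y : ℕ) : ℝ)) 0

/-- Single-period average cost `Q_f(y)`. -/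
def avgCost {n : ℕ} (h b : ℝ) (f : Fin (n + 1) → ℝ) (y : Fin (n + 1)) : ℝ :=
  ∑ d, f d * periodCost h b y d

/-- `Q*_f`, the minimum of `Q_f(y)` over `y = 0, ..., n`. -/
def minCost {n : ℕ} (h b : ℝ) (f : Fin (n + 1) → ℝ) : ℝ :=
  Finset.univ.inf' Finset.univ_nonempty (avgCost h b f)

/-- An adaptive policy: `y t (d_1, ..., d_t)` is the order-up-to level of period `t + 1`, chosen
after the demands of periods `1, ..., t` have been observed. -/
abbrev Policy (n : ℕ) : Type :=
  (t : ℕ) → (Fin t → Fin (n + 1)) → Fin (n + 1)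

/-- The `T`-period total average cost of a policy. The summand with index `t` belongs to period
`t + 1`, in which the demands `d_1, ..., d_t` are known and `d_{t + 1} = d (Fin.last t)` is
faced. -/
def totalCost {n : ℕ} (h b : ℝ) (f : Fin (n + 1) → ℝ) (y : Policy n) (T : ℕ) : ℝ :=
  ∑ t ∈ Finset.range T,
    expect f (t + 1) fun d => periodCost h b (y t (Fin.init d)) (d (Fin.last t))

/-- The `T`-period regret. -/
def regret {n : ℕ} (h b : ℝ) (f : Fin (n + 1) → ℝ) (y : Policy n) (T : ℕ) : ℝ :=
  totalCost h b f y T - minCost h b f * T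

/-- The empirical-newsvendor policy for nonperishable items: order nothing in period 1, and in
each later period order up to the empirical `β`-quantile or, if that is larger, stay at the
inventory carried over. Natural subtraction takes the positive part of the carried-over
inventory, which does not alter the maximum; see `empiricalPolicy_succ`. -/
def empiricalPolicy {n : ℕ} (β : ℝ) : Policy n
  | 0, _ => 0
  | t + 1, d =>
      max (quantile β (empirical d))
        ⟨(empiricalPolicy β t (Fin.init d) : ℕ) - (d (Fin.last t) : ℕ),
          lt_of_le_of_lt (Nat.sub_le _ _) (Fin.is_lt _)⟩

/-- The recursion over the integers, with `y_t - d_t` possibly negative. -/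
theorem empiricalPolicy_succ {n : ℕ} (β : ℝ) (t : ℕ) (d : Fin (t + 1) → Fin (n + 1)) :
    ((empiricalPolicy β (t + 1) d : ℕ) : ℤ) =
      max ((quantile β (empirical d) : ℕ) : ℤ)
        (((empiricalPolicy β t (Fin.init d) : ℕ) : ℤ) - ((d (Fin.last t) : ℕ) : ℤ)) := by
  have hmax : ∀ a c : Fin (n + 1), ((max a c : Fin (n + 1)) : ℕ) = max (a : ℕ) (c : ℕ) :=
    fun a c => by
      rcases le_total a c with h | h
      · rw [max_eq_right h, max_eq_right (Fin.le_def.mp h)]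
      · rw [max_eq_left h, max_eq_left (Fin.le_def.mp h)]
  rw [empiricalPolicy, hmax]
  simp only
  omega

end Newsvendor

end

/-!
The regret is in fact of order `√T`, uniformly in `f`.

Layer by layer, the cost of an order-up-to level `y` is a sum over `d` of `h F_f(d)` if `d < y` and
`b (1 - F_f(d))` if `y ≤ d`. Hence the excess of `Q_f(y)` over the minimum is at most `h + b` times
the sum over `d` of `(F_f(d) - β)⁺` over the layers `d < y` and of `(β - F_f(d))⁺` over the layers
`y ≤ d` (`avgCost_sub_le`), and the two kinds of layers can be treated separately.

*Understock.* The policy never goes below the empirical quantile, so `y_t ≤ d` forces `F̂(d) ≥ β`,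
and then `(β - F_f(d))⁺ ≤ |F̂(d) - F_f(d)|`. Its mean is at most `1 / √t` because the variance of
`F̂(d)` is `F_f(d) (1 - F_f(d)) / t` (`expect_empirical_sq`).

*Overstock.* The process `z_t = (y_t - d)⁺` is at most `n` (the largest possible demand), jumps up
only when `F̂(d) < β`, and while it is positive it loses at least one unit whenever the demand is
positive, that is, with probability `p = 1 - f(0)`. So `p ∑ P(d < y_t)` is at most `n ∑ P(F̂(d) <
β)` (`expect_drift`). If `p` is at least `c = (1 - β) / 2`, the same mean deviation bound applies.
If `p < c`, then `F_f(d) ≥ 1 - p ≥ β + c`, and Chebyshev's inequality bounds `P(F̂(d) < β)` by a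
multiple of `p / t`, whose factor `p` cancels the slow depletion of the stock.
-/

namespace Newsvendor

/-! ### Expectations over independent demands -/

section Expect

variable {n : ℕ} {f : Fin (n + 1) → ℝ} {t : ℕ}

theorem expect_mono (hf : f ∈ stdSimplex ℝ (Fin (n + 1))) {g g' : (Fin t → Fin (n + 1)) → ℝ}
    (hg : ∀ d, g d ≤ g' d) : expect f t g ≤ expect f t g' :=
  Finset.sum_le_sum fun d _ =>
    mul_le_mul_of_nonneg_left (hg d) (Finset.prod_nonneg fun s _ => hf.1 (d s))

theorem expect_add (g g' : (Fin t → Fin (n + 1)) → ℝ) :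
    expect f t (fun d => g d + g' d) = expect f t g + expect f t g' := by
  simp only [expect, mul_add, Finset.sum_add_distrib]

theorem expect_const_mul (c : ℝ) (g : (Fin t → Fin (n + 1)) → ℝ) :
    expect f t (fun d => c * g d) = c * expect f t g := by
  simp only [expect, Finset.mul_sum]
  exact Finset.sum_congr rfl fun d _ => by ring

theorem expect_finset_sum {ι : Type*} (s : Finset ι) (g : ι → (Fin t → Fin (n + 1)) → ℝ) :
    expect f t (fun d => ∑ i ∈ s, g i d) = ∑ i ∈ s, expect f t (g i) := by
  simp only [expect, Finset.mul_sum]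
  exact Finset.sum_comm

/-- Conditioning on the past: the last demand can be averaged out first. -/
theorem expect_succ (g : (Fin (t + 1) → Fin (n + 1)) → ℝ) :
    expect f (t + 1) g = expect f t fun d => ∑ x, f x * g (Fin.snoc d x) := by
  unfold expect
  rw [← (Fin.snocEquiv fun _ : Fin (t + 1) => Fin (n + 1)).sum_comp, Fintype.sum_prod_type,
    Finset.sum_comm]
  refine Finset.sum_congr rfl fun d _ => ?_
  rw [Finset.mul_sum]
  refine Finset.sum_congr rfl fun x _ => ?_
  change (∏ s, f ((Fin.snoc d x : Fin (t + 1) → Fin (n + 1)) s)) * g (Fin.snoc d x) = _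
  simp only [Fin.prod_univ_castSucc, Fin.snoc_castSucc, Fin.snoc_last]
  ring

theorem expect_const (hf : f ∈ stdSimplex ℝ (Fin (n + 1))) (c : ℝ) :
    expect f t (fun _ => c) = c := by
  induction t with
  | zero => simp [expect]
  | succ t ih => rw [expect_succ, ← Finset.sum_mul, hf.2, one_mul, ih]

theorem expect_nonneg (hf : f ∈ stdSimplex ℝ (Fin (n + 1))) {g : (Fin t → Fin (n + 1)) → ℝ}
    (hg : ∀ d, 0 ≤ g d) : 0 ≤ expect f t g :=
  (expect_const hf 0).symm.le.trans (expect_mono hf hg)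

end Expect

/-! ### The distribution function and the empirical distribution -/

section Empirical

variable {n : ℕ} {f : Fin (n + 1) → ℝ}

theorem cdf_eq_sum_ite (f : Fin (n + 1) → ℝ) (d : Fin (n + 1)) :
    cdf f d = ∑ x, f x * (if x ≤ d then 1 else 0) := by
  simp only [cdf, mul_ite, mul_one, mul_zero, ← Finset.sum_filter]
  exact Finset.sum_congr (by ext; simp) fun _ _ => rfl

theorem cdf_mono (hf : f ∈ stdSimplex ℝ (Fin (n + 1))) : Monotone (cdf f) := fun _ _ h =>
  Finset.sum_le_sum_of_subset_of_nonneg (Finset.Iic_subset_Iic.mpr h) fun i _ _ => hf.1 i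

theorem cdf_nonneg (hf : f ∈ stdSimplex ℝ (Fin (n + 1))) (d : Fin (n + 1)) : 0 ≤ cdf f d :=
  Finset.sum_nonneg fun i _ => hf.1 i

theorem cdf_le_one (hf : f ∈ stdSimplex ℝ (Fin (n + 1))) (d : Fin (n + 1)) : cdf f d ≤ 1 := by
  rw [← hf.2]
  exact Finset.sum_le_sum_of_subset_of_nonneg (Finset.subset_univ _) fun i _ _ => hf.1 i

theorem apply_zero_le_cdf (hf : f ∈ stdSimplex ℝ (Fin (n + 1))) (d : Fin (n + 1)) :
    f 0 ≤ cdf f d :=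
  Finset.single_le_sum (f := f) (fun i _ => hf.1 i) (Finset.mem_Iic.mpr (Fin.zero_le d))

theorem quantile_le_iff {β : ℝ} (hβ : β ≤ 1) (hf : f ∈ stdSimplex ℝ (Fin (n + 1)))
    (d : Fin (n + 1)) : quantile β f ≤ d ↔ β ≤ cdf f d :=
  ⟨fun h => (quantile_isLeast hβ hf).1.trans (cdf_mono hf h),
    fun h => (quantile_isLeast hβ hf).2 h⟩

theorem cdf_empirical {t : ℕ} (w : Fin t → Fin (n + 1)) (d : Fin (n + 1)) :
    cdf (empirical w) d = (∑ s, if w s ≤ d then (1 : ℝ) else 0) / t := by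
  rw [cdf_eq_sum_ite]
  have h : ∀ s, (if w s ≤ d then (1 : ℝ) else 0) =
      ∑ x, (if w s = x then (1 : ℝ) else 0) * (if x ≤ d then 1 else 0) := fun s => by
    simp only [ite_mul, one_mul, zero_mul, Finset.sum_ite_eq, Finset.mem_univ, if_true]
  simp only [empirical, h]
  rw [Finset.sum_comm, Finset.sum_div]
  refine Finset.sum_congr rfl fun x _ => ?_
  rw [← Finset.sum_mul, Finset.sum_boole]
  ring

/-- Second moment of a sum of independent centred variables: the cross terms vanish. -/
theorem expect_sum_sq (hf : f ∈ stdSimplex ℝ (Fin (n + 1))) (ξ : Fin (n + 1) → ℝ)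
    (hξ : ∑ x, f x * ξ x = 0) (t : ℕ) :
    expect f t (fun w => (∑ s, ξ (w s)) ^ 2) = t * ∑ x, f x * ξ x ^ 2 := by
  induction t with
  | zero => simp [expect]
  | succ t ih =>
    have key : ∀ w : Fin t → Fin (n + 1),
        ∑ x, f x * (∑ s, ξ ((Fin.snoc w x : Fin (t + 1) → Fin (n + 1)) s)) ^ 2
          = (∑ s, ξ (w s)) ^ 2 + ∑ x, f x * ξ x ^ 2 := fun w => by
      have h : ∀ x, f x * (∑ s, ξ ((Fin.snoc w x : Fin (t + 1) → Fin (n + 1)) s)) ^ 2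
          = f x * (∑ s, ξ (w s)) ^ 2 + 2 * (∑ s, ξ (w s)) * (f x * ξ x) + f x * ξ x ^ 2 :=
        fun x => by
          simp only [Fin.sum_univ_castSucc, Fin.snoc_castSucc, Fin.snoc_last]
          ring
      simp only [h, Finset.sum_add_distrib, ← Finset.mul_sum, ← Finset.sum_mul, hξ, hf.2]
      ring
    rw [expect_succ]
    simp only [key]
    rw [expect_add, ih, expect_const hf]
    push_cast
    ring

theorem expect_empirical_sq (hf : f ∈ stdSimplex ℝ (Fin (n + 1))) (d : Fin (n + 1)) (t : ℕ) :
    expect f (t + 1) (fun w => (cdf (empirical w) d - cdf f d) ^ 2)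
      = cdf f d * (1 - cdf f d) / (t + 1) := by
  set F := cdf f d with hF
  have ht : (t + 1 : ℝ) ≠ 0 := by positivity
  set ξ : Fin (n + 1) → ℝ := fun x => (if x ≤ d then 1 else 0) - F with hξ
  have hmean : ∑ x, f x * ξ x = 0 := by
    simp only [hξ, mul_sub, Finset.sum_sub_distrib, ← Finset.sum_mul, hf.2]
    rw [← cdf_eq_sum_ite]
    ring
  have hvar : ∑ x, f x * ξ x ^ 2 = F * (1 - F) := by
    have h : ∀ x, f x * ξ x ^ 2
        = (1 - 2 * F) * (f x * (if x ≤ d then 1 else 0)) + F ^ 2 * f x := fun x => by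
      simp only [hξ]
      split_ifs <;> ring
    simp only [h, Finset.sum_add_distrib, ← Finset.mul_sum, hf.2]
    rw [← cdf_eq_sum_ite]
    ring
  have h : ∀ w : Fin (t + 1) → Fin (n + 1), (cdf (empirical w) d - F) ^ 2
      = ((t + 1 : ℝ) ^ 2)⁻¹ * (∑ s, ξ (w s)) ^ 2 := fun w => by
    rw [cdf_empirical]
    simp only [hξ, Finset.sum_sub_distrib, Finset.sum_const, Finset.card_univ, Fintype.card_fin,
      nsmul_eq_mul]
    push_cast
    field_simp
  simp only [h]
  rw [expect_const_mul, expect_sum_sq hf ξ hmean, hvar]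
  push_cast
  field_simp

theorem expect_empirical_abs (hf : f ∈ stdSimplex ℝ (Fin (n + 1))) (d : Fin (n + 1)) (t : ℕ) :
    expect f (t + 1) (fun w => |cdf (empirical w) d - cdf f d|) ≤ 1 / √(t + 1 : ℝ) := by
  set r := √(t + 1 : ℝ) with hr
  have hrpos : 0 < r := Real.sqrt_pos.mpr (by positivity)
  have hr2 : r ^ 2 = t + 1 := Real.sq_sqrt (by positivity)
  -- the inequality of arithmetic and geometric means, in place of Cauchy-Schwarz
  have hpt : ∀ w : Fin (t + 1) → Fin (n + 1), |cdf (empirical w) d - cdf f d|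
      ≤ r * (cdf (empirical w) d - cdf f d) ^ 2 + 1 / (4 * r) := fun w => by
    rw [← sq_abs (cdf (empirical w) d - cdf f d)]
    generalize |cdf (empirical w) d - cdf f d| = x
    have : r * x ^ 2 + 1 / (4 * r) - x = r * (x - 1 / (2 * r)) ^ 2 := by
      field_simp
      ring
    have : 0 ≤ r * (x - 1 / (2 * r)) ^ 2 := by positivity
    linarith
  refine (expect_mono hf hpt).trans ?_
  rw [expect_add, expect_const hf, expect_const_mul, expect_empirical_sq hf, ← hr2]
  have hF : cdf f d * (1 - cdf f d) ≤ 1 / 4 := by nlinarith [sq_nonneg (cdf f d - 1 / 2)]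
  calc r * (cdf f d * (1 - cdf f d) / r ^ 2) + 1 / (4 * r)
      = (cdf f d * (1 - cdf f d) + 1 / 4) / r := by field_simp
    _ ≤ 1 / r := by gcongr; linarith

end Empirical

/-! ### Decomposition of the cost into layers -/

section Cost

variable {n : ℕ} {f : Fin (n + 1) → ℝ}

theorem sum_ite_le_lt (x y : Fin (n + 1)) :
    (∑ d : Fin (n + 1), if x ≤ d ∧ d < y then (1 : ℝ) else 0)
      = max (((y : ℕ) : ℝ) - ((x : ℕ) : ℝ)) 0 := by
  rw [Finset.sum_boole]
  have : (Finset.univ.filter fun d : Fin (n + 1) => x ≤ d ∧ d < y) = Finset.Ico x y := by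
    ext; simp
  rw [this, Fin.card_Ico]
  rcases le_total (x : ℕ) (y : ℕ) with h | h
  · rw [Nat.cast_sub h, max_eq_left (sub_nonneg.mpr (by exact_mod_cast h))]
  · rw [Nat.sub_eq_zero_of_le h, max_eq_right (sub_nonpos.mpr (by exact_mod_cast h))]
    simp

theorem avgCost_eq_sum (hf : f ∈ stdSimplex ℝ (Fin (n + 1))) (h b : ℝ) (y : Fin (n + 1)) :
    avgCost h b f y = ∑ d, if d < y then h * cdf f d else b * (1 - cdf f d) := by
  have hcost : ∀ x, f x * periodCost h b y x = ∑ d : Fin (n + 1),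
      if d < y then h * (f x * if x ≤ d then 1 else 0)
      else b * (f x - f x * if x ≤ d then 1 else 0) := fun x => by
    rw [periodCost, ← sum_ite_le_lt, ← sum_ite_le_lt, Finset.mul_sum, Finset.mul_sum,
      ← Finset.sum_add_distrib, Finset.mul_sum]
    refine Finset.sum_congr rfl fun d _ => ?_
    by_cases h1 : d < y <;> by_cases h2 : x ≤ d
    · simp [h1, h2, not_le.mpr h1]; ring
    · simp [h1, h2, not_le.mpr h1]
    · simp [h1, h2, not_lt.mpr h2]
    · simp [h1, h2, not_lt.mp h1, not_le.mp h2]; ring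
  simp only [avgCost, hcost]
  rw [Finset.sum_comm]
  refine Finset.sum_congr rfl fun d _ => ?_
  split_ifs
  · rw [← Finset.mul_sum, ← cdf_eq_sum_ite]
  · rw [← Finset.mul_sum, Finset.sum_sub_distrib, hf.2, ← cdf_eq_sum_ite]

/-- Bound on the excess cost of level `y` over any other level. In each layer the comparison level
either makes the same choice, with no excess, or the opposite one, with excess
`± (h + b) (F_f(d) - β)`. -/
theorem avgCost_sub_le (hf : f ∈ stdSimplex ℝ (Fin (n + 1))) {h b : ℝ} (hhb : 0 < h + b)
    (y y' : Fin (n + 1)) :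
    avgCost h b f y - avgCost h b f y' ≤ (h + b) * ∑ d,
      (max (cdf f d - b / (h + b)) 0 * (if d < y then 1 else 0)
        + max (b / (h + b) - cdf f d) 0 * (if y ≤ d then 1 else 0)) := by
  rw [avgCost_eq_sum hf, avgCost_eq_sum hf, ← Finset.sum_sub_distrib, Finset.mul_sum]
  refine Finset.sum_le_sum fun d _ => ?_
  generalize cdf f d = F
  have hb : (h + b) * (b / (h + b)) = b := by field_simp
  generalize b / (h + b) = β at hb
  have h0 : 0 ≤ (h + b) * max (F - β) 0 := by positivity
  have h1 : (h + b) * (F - β) ≤ (h + b) * max (F - β) 0 := by gcongr; exact le_max_left _ _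
  have h2 : 0 ≤ (h + b) * max (β - F) 0 := by positivity
  have h3 : (h + b) * (β - F) ≤ (h + b) * max (β - F) 0 := by gcongr; exact le_max_left _ _
  by_cases hy : d < y
  · simp only [hy, not_le.mpr hy, if_true, if_false, mul_one, mul_zero, add_zero]
    split_ifs <;> linarith
  · simp only [hy, not_lt.mp hy, if_true, if_false, mul_one, mul_zero, zero_add]
    split_ifs <;> linarith

theorem regret_le_sum (hf : f ∈ stdSimplex ℝ (Fin (n + 1))) {h b : ℝ} (hhb : 0 < h + b)
    (y : Policy n) (T : ℕ) :
    regret h b f y T ≤ (h + b) * ∑ d,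
      (max (cdf f d - b / (h + b)) 0
          * (∑ t ∈ Finset.range T, expect f t fun w => if d < y t w then 1 else 0)
        + max (b / (h + b) - cdf f d) 0
          * ∑ t ∈ Finset.range T, expect f t fun w => if y t w ≤ d then 1 else 0) := by
  obtain ⟨y', -, hy'⟩ := Finset.exists_mem_eq_inf' (Finset.univ_nonempty (α := Fin (n + 1)))
    (avgCost h b f)
  have hterm : ∀ t, expect f (t + 1)
      (fun d => periodCost h b (y t (Fin.init d)) (d (Fin.last t))) ≤ (h + b) * ∑ d,
      (max (cdf f d - b / (h + b)) 0 * (expect f t fun w => if d < y t w then 1 else 0)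
        + max (b / (h + b) - cdf f d) 0 * expect f t fun w => if y t w ≤ d then 1 else 0)
      + minCost h b f := fun t => by
    rw [expect_succ]
    simp only [Fin.init_snoc, Fin.snoc_last]
    refine (expect_mono hf fun w => show _ ≤ _ from
      sub_le_iff_le_add.mp (avgCost_sub_le hf hhb (y t w) y')).trans_eq ?_
    rw [expect_add, expect_const hf, expect_const_mul, expect_finset_sum, minCost, hy']
    simp only [expect_add, expect_const_mul]
  rw [regret, totalCost, sub_le_iff_le_add]
  refine (Finset.sum_le_sum fun t _ => hterm t).trans_eq ?_
  rw [Finset.sum_add_distrib, ← Finset.mul_sum, Finset.sum_comm]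
  simp only [Finset.sum_add_distrib, ← Finset.mul_sum, Finset.sum_const, Finset.card_range,
    nsmul_eq_mul]
  ring

end Cost

/-! ### Understock and overstock of the empirical policy -/

section EmpiricalPolicy

variable {n : ℕ} {f : Fin (n + 1) → ℝ} {β : ℝ}

theorem sum_one_div_sqrt_le (T : ℕ) :
    ∑ t ∈ Finset.range T, 1 / √(t + 1 : ℝ) ≤ 2 * √(T : ℝ) := by
  induction T with
  | zero => simp
  | succ T ih =>
    rw [Finset.sum_range_succ]
    push_cast
    have h1 : √(T : ℝ) ^ 2 = T := Real.sq_sqrt (by positivity)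
    have h2 : √(T + 1 : ℝ) ^ 2 = T + 1 := Real.sq_sqrt (by positivity)
    have h3 : 0 < √(T + 1 : ℝ) := Real.sqrt_pos.mpr (by positivity)
    have h4 : 1 / √(T + 1 : ℝ) ≤ 2 * √(T + 1 : ℝ) - 2 * √(T : ℝ) := by
      rw [div_le_iff₀ h3]
      nlinarith [sq_nonneg (√(T + 1 : ℝ) - √(T : ℝ))]
    linarith

/-- Understock bound, for one period: the level is at least the empirical quantile, so it can be too
low only by as much as the empirical distribution function is too high. -/
theorem understock_term_le (hf : f ∈ stdSimplex ℝ (Fin (n + 1))) (hβ : β ≤ 1) (d : Fin (n + 1))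
    (t : ℕ) :
    max (β - cdf f d) 0 * (expect f t fun w => if empiricalPolicy β t w ≤ d then 1 else 0)
      ≤ 2 * (1 / √(t + 1 : ℝ)) := by
  rcases t with _ | t
  · have h1 : max (β - cdf f d) 0 ≤ 1 :=
      max_le (by linarith [cdf_nonneg hf d]) zero_le_one
    have h2 : (expect f 0 fun w => if empiricalPolicy β 0 w ≤ d then 1 else 0) = 1 := by
      simp [expect, empiricalPolicy]
    rw [h2]
    norm_num
    linarith [h1.trans' (le_max_left _ _)]
  · rw [← expect_const_mul]
    refine (expect_mono hf fun w => show _ ≤ |cdf (empirical w) d - cdf f d| from ?_).trans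
      ((expect_empirical_abs hf d t).trans ?_)
    · split_ifs with hy
      · have hq : β ≤ cdf (empirical w) d :=
          (quantile_le_iff hβ (empirical_mem (Nat.succ_pos t) w) d).mp
            ((le_max_left _ _).trans hy)
        rw [mul_one]
        exact max_le (by linarith [le_abs_self (cdf (empirical w) d - cdf f d)]) (abs_nonneg _)
      · simp
    · have h1 : √((t + 1 : ℕ) + 1 : ℝ) ≤ 2 * √(t + 1 : ℝ) := by
        rw [show (2 : ℝ) = √4 by norm_num, ← Real.sqrt_mul (by norm_num)]
        apply Real.sqrt_le_sqrt
        push_cast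
        linarith [t.cast_nonneg (α := ℝ)]
      rw [mul_one_div, div_le_div_iff₀ (by positivity) (by positivity)]
      linarith

/-- Drift inequality for the overstock process `(y_t - d)⁺`. -/
theorem expect_drift (hf : f ∈ stdSimplex ℝ (Fin (n + 1))) (hβ : β ≤ 1) (d : Fin (n + 1))
    (T : ℕ) :
    (expect f T fun w => (((empiricalPolicy β T w : ℕ) - (d : ℕ) : ℕ) : ℝ))
        + (1 - f 0) * ∑ t ∈ Finset.range T,
            expect f t (fun w => if d < empiricalPolicy β t w then 1 else 0)
      ≤ n * ∑ t ∈ Finset.range T,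
            expect f (t + 1) fun w => if cdf (empirical w) d < β then 1 else 0 := by
  induction T with
  | zero => simp [expect, empiricalPolicy]
  | succ T ih =>
    have hstep : ∀ (w : Fin T → Fin (n + 1)) (x : Fin (n + 1)),
        (((empiricalPolicy β (T + 1) (Fin.snoc w x : Fin (T + 1) → Fin (n + 1)) : ℕ)
            - (d : ℕ) : ℕ) : ℝ)
          + (if x = 0 then 0 else 1) * (if d < empiricalPolicy β T w then 1 else 0)
        ≤ (((empiricalPolicy β T w : ℕ) - (d : ℕ) : ℕ) : ℝ)
          + n * (if cdf (empirical (Fin.snoc w x : Fin (T + 1) → Fin (n + 1))) d < β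
              then 1 else 0) := fun w x => by
      have hrec := empiricalPolicy_succ β T (Fin.snoc w x : Fin (T + 1) → Fin (n + 1))
      rw [Fin.init_snoc, Fin.snoc_last] at hrec
      have hq := quantile_le_iff hβ
        (empirical_mem (Nat.succ_pos T) (Fin.snoc w x : Fin (T + 1) → Fin (n + 1))) d
      have hlt := (empiricalPolicy β (T + 1) (Fin.snoc w x : Fin (T + 1) → Fin (n + 1))).is_lt
      rw [← not_lt (b := β), Fin.le_def] at hq
      have hnat : ((empiricalPolicy β (T + 1) (Fin.snoc w x : Fin (T + 1) → Fin (n + 1)) : ℕ)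
            - (d : ℕ)) + (if x = 0 then 0 else 1) * (if d < empiricalPolicy β T w then 1 else 0)
          ≤ ((empiricalPolicy β T w : ℕ) - (d : ℕ))
            + n * (if cdf (empirical (Fin.snoc w x : Fin (T + 1) → Fin (n + 1))) d < β
              then 1 else 0) := by
        have hy := (empiricalPolicy β T w).is_lt
        simp only [Fin.lt_def, Fin.ext_iff, Fin.val_zero]
        by_cases h1 : cdf (empirical (Fin.snoc w x : Fin (T + 1) → Fin (n + 1))) d < β
        · simp only [h1, if_true]
          split_ifs <;> omega
        · have hq1 := hq.mpr h1
          simp only [h1, if_false]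
          split_ifs <;> omega
      exact_mod_cast hnat
    have hexp := expect_mono (f := f) (t := T) hf fun w =>
      Finset.sum_le_sum fun x (_ : x ∈ Finset.univ) => mul_le_mul_of_nonneg_left (hstep w x) (hf.1 x)
    have hp : ∑ x, f x * (if x = 0 then (0 : ℝ) else 1) = 1 - f 0 := by
      have h1 := hf.2
      rw [Fin.sum_univ_succ] at h1 ⊢
      simp only [Fin.succ_ne_zero, if_true, if_false, mul_zero, mul_one]
      linarith
    simp only [mul_add, Finset.sum_add_distrib, expect_add, ← Finset.sum_mul, hf.2, one_mul,
      ← mul_assoc, hp, expect_const_mul] at hexp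
    simp only [mul_comm _ (n : ℝ), mul_assoc, ← Finset.mul_sum, expect_const_mul] at hexp
    rw [← expect_succ (f := f) (fun w => (((empiricalPolicy β (T + 1) w : ℕ) - (d : ℕ) : ℕ) : ℝ)),
      ← expect_succ (f := f) (fun w => if cdf (empirical w) d < β then (1 : ℝ) else 0)] at hexp
    rw [Finset.sum_range_succ, Finset.sum_range_succ, mul_add, mul_add]
    linarith

/-- Overstock bound. The constant involves `c = (1 - β) / 2`, which separates the demand
distributions with `P(D > 0) ≥ c`, under which excess stock is depleted fast, from those under
which `F_f(d)` exceeds `β` by at least `c` for every `d`. -/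
theorem overstock_sum_le (hf : f ∈ stdSimplex ℝ (Fin (n + 1))) (hβ0 : 0 ≤ β) (hβ : β < 1)
    (d : Fin (n + 1)) (T : ℕ) :
    max (cdf f d - β) 0 * (∑ t ∈ Finset.range T,
        expect f t fun w => if d < empiricalPolicy β t w then 1 else 0)
      ≤ (n / ((1 - β) / 2) + n / ((1 - β) / 2) ^ 2) * (2 * √(T : ℝ)) := by
  set c := (1 - β) / 2 with hc
  have hcpos : 0 < c := by rw [hc]; linarith
  set S : ℕ → ℝ := fun T => ∑ t ∈ Finset.range T,
    expect f t (fun w => if d < empiricalPolicy β t w then 1 else 0) with hS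
  set A : ℕ → ℝ := fun t =>
    expect f (t + 1) fun w => if cdf (empirical w) d < β then 1 else 0 with hA
  set p := 1 - f 0 with hp
  have hp0 : 0 ≤ p := by linarith [apply_zero_le_cdf hf d, cdf_le_one hf d]
  have hFp : 1 - p ≤ cdf f d := by linarith [apply_zero_le_cdf hf d]
  have ha0 : 0 ≤ max (cdf f d - β) 0 := le_max_right _ _
  have ha1 : max (cdf f d - β) 0 ≤ 1 := max_le (by linarith [cdf_le_one hf d]) zero_le_one
  have hS0 : 0 ≤ S T := Finset.sum_nonneg fun t _ =>
    expect_nonneg hf fun w => by split_ifs <;> norm_num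
  have hdrift : ∀ T, (expect f T fun w => (((empiricalPolicy β T w : ℕ) - (d : ℕ) : ℕ) : ℝ))
      + p * S T ≤ n * ∑ t ∈ Finset.range T, A t := expect_drift hf hβ.le d
  have hpS : p * S T ≤ n * ∑ t ∈ Finset.range T, A t :=
    (le_add_of_nonneg_left (expect_nonneg hf fun w => by positivity)).trans (hdrift T)
  have hR : (0 : ℝ) ≤ 2 * √(T : ℝ) := by positivity
  have hn1 : 0 ≤ n / c * (2 * √(T : ℝ)) := by positivity
  have hn2 : 0 ≤ n / c ^ 2 * (2 * √(T : ℝ)) := by positivity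
  rw [add_mul]
  rcases le_or_gt c p with hcp | hcp
  · -- frequent positive demand: the mean deviation bound suffices
    have hAt : ∀ t, max (cdf f d - β) 0 * A t ≤ 1 / √(t + 1 : ℝ) := fun t => by
      rw [hA, ← expect_const_mul]
      refine (expect_mono hf fun w => ?_).trans (expect_empirical_abs hf d t)
      split_ifs with hw
      · rw [mul_one]
        exact max_le (by linarith [neg_abs_le (cdf (empirical w) d - cdf f d)]) (abs_nonneg _)
      · simp
    have h1 : max (cdf f d - β) 0 * ∑ t ∈ Finset.range T, A t ≤ 2 * √(T : ℝ) := by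
      rw [Finset.mul_sum]
      exact (Finset.sum_le_sum fun t _ => hAt t).trans (sum_one_div_sqrt_le T)
    have h2 : c * (max (cdf f d - β) 0 * S T) ≤ n * (2 * √(T : ℝ)) :=
      calc c * (max (cdf f d - β) 0 * S T) ≤ p * (max (cdf f d - β) 0 * S T) := by gcongr
        _ = max (cdf f d - β) 0 * (p * S T) := by ring
        _ ≤ max (cdf f d - β) 0 * (n * ∑ t ∈ Finset.range T, A t) := by gcongr
        _ = n * (max (cdf f d - β) 0 * ∑ t ∈ Finset.range T, A t) := by ring
        _ ≤ n * (2 * √(T : ℝ)) := by gcongr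
    have h3 : max (cdf f d - β) 0 * S T ≤ n / c * (2 * √(T : ℝ)) := by
      rw [div_mul_eq_mul_div, le_div_iff₀ hcpos]
      linarith
    linarith
  · -- rare positive demand: Chebyshev's inequality, with variance at most `p / (t + 1)`
    have hgap : c ≤ cdf f d - β := by rw [hc] at hcp ⊢; linarith
    have hAt : ∀ t, A t ≤ p / c ^ 2 * (1 / (t + 1 : ℝ)) := fun t => by
      have h1 : c ^ 2 * A t ≤ cdf f d * (1 - cdf f d) / (t + 1) := by
        rw [hA, ← expect_const_mul, ← expect_empirical_sq hf]
        refine expect_mono hf fun w => ?_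
        split_ifs with hw
        · rw [mul_one]
          nlinarith
        · simpa using sq_nonneg _
      have h2 : cdf f d * (1 - cdf f d) ≤ p := by
        nlinarith [cdf_nonneg hf d, cdf_le_one hf d]
      have h3 : c ^ 2 * A t ≤ p / (t + 1) := h1.trans (by gcongr)
      calc A t = c ^ 2 * A t / c ^ 2 := by field_simp
        _ ≤ p / (t + 1) / c ^ 2 := by gcongr
        _ = p / c ^ 2 * (1 / (t + 1 : ℝ)) := by ring
    have hsum : ∀ T : ℕ, ∑ t ∈ Finset.range T, A t ≤ p / c ^ 2 * (2 * √(T : ℝ)) := fun T => by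
      refine (Finset.sum_le_sum fun t _ => hAt t).trans ?_
      rw [← Finset.mul_sum]
      gcongr
      refine (Finset.sum_le_sum fun t _ => ?_).trans (sum_one_div_sqrt_le T)
      have h1 : (1 : ℝ) ≤ t + 1 := by linarith [t.cast_nonneg (α := ℝ)]
      exact one_div_le_one_div_of_le (by positivity) (Real.sqrt_le_iff.mpr ⟨by linarith, by nlinarith⟩)
    have hST : S T ≤ n / c ^ 2 * (2 * √(T : ℝ)) := by
      rcases hp0.eq_or_lt with hp00 | hppos
      · -- no depletion at all, but then there is never any excess stock either
        have hz : S T ≤ 0 := Finset.sum_nonpos fun t _ => by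
          have h1 := hdrift t
          have h2 := mul_le_mul_of_nonneg_left (hsum t) n.cast_nonneg
          rw [← hp00] at h1 h2
          simp only [zero_mul, add_zero, zero_div, mul_zero] at h1 h2
          refine (expect_mono hf fun w => ?_).trans (h1.trans h2)
          split_ifs with hw
          · exact_mod_cast Nat.sub_pos_of_lt hw
          · positivity
        exact hz.trans hn2
      · refine le_of_mul_le_mul_left (hpS.trans ?_) hppos
        calc n * ∑ t ∈ Finset.range T, A t ≤ n * (p / c ^ 2 * (2 * √(T : ℝ))) := by
              gcongr
              exact hsum T
          _ = p * (n / c ^ 2 * (2 * √(T : ℝ))) := by ring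
    have : max (cdf f d - β) 0 * S T ≤ S T := mul_le_of_le_one_left hS0 ha1
    linarith

/-- The factor in the bound `regret ≤ regretConst n h b * √T` for the empirical policy. -/
noncomputable def regretConst (n : ℕ) (h b : ℝ) : ℝ :=
  (h + b) * ((n + 1) * ((n / ((1 - b / (h + b)) / 2) + n / ((1 - b / (h + b)) / 2) ^ 2) * 2 + 4))

theorem regret_empiricalPolicy_le (hf : f ∈ stdSimplex ℝ (Fin (n + 1))) {h b : ℝ} (hh : 0 < h)
    (hb : 0 < b) (T : ℕ) :
    regret h b f (empiricalPolicy (b / (h + b))) T ≤ regretConst n h b * √(T : ℝ) := by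
  have hhb : 0 < h + b := by positivity
  have hβ0 : 0 ≤ b / (h + b) := by positivity
  have hβ : b / (h + b) < 1 := by rw [div_lt_one hhb]; linarith
  refine (regret_le_sum hf hhb _ T).trans ?_
  rw [regretConst, mul_assoc]
  refine mul_le_mul_of_nonneg_left ?_ hhb.le
  have hd : ∀ d : Fin (n + 1), _ := fun d => add_le_add (overstock_sum_le hf hβ0 hβ d T)
    ((Finset.mul_sum _ _ _).trans_le
      ((Finset.sum_le_sum fun t _ => understock_term_le hf hβ.le d t).trans
        ((Finset.mul_sum _ _ _).symm.trans_le
          (mul_le_mul_of_nonneg_left (sum_one_div_sqrt_le T) zero_le_two))))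
  refine (Finset.sum_le_sum fun d _ => hd d).trans_eq ?_
  rw [Finset.sum_const, Finset.card_univ, Fintype.card_fin, nsmul_eq_mul]
  push_cast
  ring

end EmpiricalPolicy

end Newsvendor

theorem mainTheorem1 (h b : ℝ) (hh : 0 < h) (hb : 0 < b) (dbar : ℕ) (hdbar : 1 ≤ dbar)
    (ε : ℝ) (hε : 0 < ε) :
    ∃ E F : ℝ, 0 < E ∧ 0 < F ∧ ∀ T : ℕ,
      BddAbove (Set.range fun f : stdSimplex ℝ (Fin (dbar + 1)) =>
        Newsvendor.regret h b f.1 (Newsvendor.empiricalPolicy (b / (h + b))) T) ∧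
      (⨆ f : stdSimplex ℝ (Fin (dbar + 1)),
        Newsvendor.regret h b f.1 (Newsvendor.empiricalPolicy (b / (h + b))) T) ≤
        E + F * (T : ℝ) ^ (1 / 2 + ε) := by
  have hK : 0 < Newsvendor.regretConst dbar h b := by
    have hβ : 0 < 1 - b / (h + b) := by
      rw [sub_pos, div_lt_one (by positivity)]
      linarith
    unfold Newsvendor.regretConst
    positivity
  refine ⟨1, Newsvendor.regretConst dbar h b, one_pos, hK, fun T => ?_⟩
  have hsqrt : √(T : ℝ) ≤ (T : ℝ) ^ (1 / 2 + ε) := by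
    rcases T.eq_zero_or_pos with rfl | hT
    · simpa using Real.rpow_nonneg le_rfl _
    · rw [Real.sqrt_eq_rpow]
      exact Real.rpow_le_rpow_of_exponent_le (by exact_mod_cast hT) (by linarith)
  have hbound : ∀ f : stdSimplex ℝ (Fin (dbar + 1)),
      Newsvendor.regret h b f.1 (Newsvendor.empiricalPolicy (b / (h + b))) T
        ≤ 1 + Newsvendor.regretConst dbar h b * (T : ℝ) ^ (1 / 2 + ε) := fun f => by
    have h1 := Newsvendor.regret_empiricalPolicy_le f.2 hh hb T
    have h2 := mul_le_mul_of_nonneg_left hsqrt hK.le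
    linarith
  refine ⟨⟨_, Set.forall_mem_range.mpr hbound⟩, ?_⟩
  have : Nonempty (stdSimplex ℝ (Fin (dbar + 1))) := ⟨⟨_, single_mem_stdSimplex ℝ 0⟩⟩
  exact ciSup_le hbound
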